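/- Theorem 4.2. Let $(M,g)$ be a hyperkähler surface, i.e. a connected smooth $4$-dimensional Riemannian manifold together with three Kähler structures $J_1,J_2,J_3$ on $(M,g)$ satisfying $J_1J_2=J_3=-J_2J_1$. (A Kähler structure on $(M,g)$ is a smooth integrable almost complex structure $J$ which is $g$-orthogonal and parallel with respect to the Levi-Civita connection of $g$.) Let $\xi$ be a smooth Killing vector field on $(M,g)$, i.e. $L_\xi g=0$. Then there are real constants $a_1,a_2,a_3$ with $a_1^2+a_2^2+a_3^2=1$ such that $J=a_1J_1+a_2J_2+a_3J_3$ is a complex structure on $M$, in fact a Kähler structure on $(M,g)$, and $\xi$ is $J$-holomorphic, i.e. $L_\xi J=0$. -/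

import Mathlib

open Bundle VectorField
open scoped Manifold ContDiff

namespace Hyperkahler

noncomputable section

section General

variable {E : Type*} [NormedAddCommGroup E] [NormedSpace ℝ E]
  {H : Type*} [TopologicalSpace H] {I : ModelWithCorners ℝ E H}
  {M : Type*} [TopologicalSpace M] [ChartedSpace H M]

/-! ### Endomorphism fields and complex structures -/

section ComplexStructure

variable (I M) in
/-- Fields of endomorphisms of the tangent bundle of `M`, i.e. (1,1)-tensor fields (with no
regularity required). -/
abbrev EndField : Type _ := Π x : M, TangentSpace I x →L[ℝ] TangentSpace I x

/-- The vector field `J X` obtained by applying an endomorphism field `J` to a vector field `X`. -/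
def EndField.app (J : EndField I M) (X : Π x : M, TangentSpace I x) :
    Π x : M, TangentSpace I x :=
  fun x ↦ J x (X x)

/-- The Nijenhuis tensor `N_J(X, Y) = [JX, JY] - J[JX, Y] - J[X, JY] - [X, Y]` at `x`, for an
almost complex structure `J`. -/
def nijenhuis (J : EndField I M) (X Y : Π x : M, TangentSpace I x) (x : M) : TangentSpace I x :=
  mlieBracket I (J.app X) (J.app Y) x - J x (mlieBracket I (J.app X) Y x)
    - J x (mlieBracket I X (J.app Y) x) - mlieBracket I X Y x

/-- The Lie derivative `(L_ξ J) X = [ξ, J X] - J [ξ, X]` at `x`. -/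
def lieDerivEnd (ξ : Π x : M, TangentSpace I x) (J : EndField I M)
    (X : Π x : M, TangentSpace I x) (x : M) : TangentSpace I x :=
  mlieBracket I ξ (J.app X) x - J x (mlieBracket I ξ X x)

variable [IsManifold I ∞ M]

/-- The vector field `ξ` is `J`-holomorphic: `L_ξ J = 0`. -/
def IsHolomorphicField (J : EndField I M) (ξ : Π x : M, TangentSpace I x) : Prop :=
  ∀ (x : M) (X : Π x : M, TangentSpace I x), MDiffAt (T% X) x → lieDerivEnd ξ J X x = 0

/-- A complex structure on `M`: a smooth endomorphism field `J` with `J² = -1` which is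
integrable, i.e. has vanishing Nijenhuis tensor. -/
structure IsComplexStructure (J : EndField I M) : Prop where
  smooth : ContMDiff I (I.prod 𝓘(ℝ, E →L[ℝ] E)) ∞
    (fun x : M ↦ TotalSpace.mk' (E →L[ℝ] E)
      (E := fun x : M ↦ TangentSpace I x →L[ℝ] TangentSpace I x) x (J x))
  sq (x : M) (v : TangentSpace I x) : J x (J x v) = -v
  integrable (x : M) (X Y : Π x : M, TangentSpace I x) :
    MDiffAt (T% X) x → MDiffAt (T% Y) x → nijenhuis J X Y x = 0

end ComplexStructure

/-! ### The Levi-Civita connection of a smooth Riemannian metric -/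

section LeviCivita

variable [RiemannianBundle (fun x : M ↦ TangentSpace I x)]

/-- The right-hand side of the Koszul formula for `2 g(∇_X Y, Z)` at the point `x`. -/
def koszul (X Y Z : Π x : M, TangentSpace I x) (x : M) : ℝ :=
  d% (fun y ↦ inner ℝ (Y y) (Z y)) x (X x) + d% (fun y ↦ inner ℝ (X y) (Z y)) x (Y x)
    - d% (fun y ↦ inner ℝ (X y) (Y y)) x (Z x)
    + inner ℝ (mlieBracket I X Y x) (Z x) - inner ℝ (mlieBracket I X Z x) (Y x)
    - inner ℝ (mlieBracket I Y Z x) (X x)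

lemma koszul_swap {X Y Z : Π x : M, TangentSpace I x} {x : M} :
    koszul X Y Z x - koszul Y X Z x = 2 * inner ℝ (mlieBracket I X Y x) (Z x) := by
  have h : (fun y : M ↦ inner ℝ (Y y) (X y)) = fun y ↦ inner ℝ (X y) (Y y) := by
    ext y; exact real_inner_comm _ _
  simp only [koszul, h, mlieBracket_swap_apply (V := Y) (W := X), inner_neg_left]
  ring

lemma koszul_add_swap {X Y Z : Π x : M, TangentSpace I x} {x : M} :
    koszul X Y Z x + koszul X Z Y x = 2 * d% (fun y ↦ inner ℝ (Y y) (Z y)) x (X x) := by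
  have h : (fun y : M ↦ inner ℝ (Z y) (Y y)) = fun y ↦ inner ℝ (Y y) (Z y) := by
    ext y; exact real_inner_comm _ _
  simp only [koszul, h, mlieBracket_swap_apply (V := Z) (W := Y), inner_neg_left]
  ring

variable [IsManifold I ∞ M]
  [IsContMDiffRiemannianBundle I ∞ E (fun x : M ↦ TangentSpace I x)]

lemma mdifferentiableAt_inner {X Y : Π x : M, TangentSpace I x} {x : M}
    (hX : MDiffAt (T% X) x) (hY : MDiffAt (T% Y) x) :
    MDiffAt (fun y ↦ (inner ℝ (X y) (Y y) : ℝ)) x :=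
  MDifferentiableAt.inner_bundle (F := E) (E := fun x : M ↦ TangentSpace I x) hX hY

variable [FiniteDimensional ℝ E]

lemma koszul_tensorial_right {X Y : Π x : M, TangentSpace I x} {x : M}
    (hX : MDiffAt (T% X) x) (hY : MDiffAt (T% Y) x) :
    TensorialAt I E (fun Z ↦ koszul X Y Z x) x where
  smul {f Z} hf hZ := by
    have : CompleteSpace E := FiniteDimensional.complete ℝ E
    simp [koszul, inner_smul_right, inner_smul_left, inner_add_left,
      mvfderiv_fun_mul hf (mdifferentiableAt_inner hY hZ), mvfderiv_fun_mul hf (mdifferentiableAt_inner hX hZ),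
      mlieBracket_smul_right hf hZ]
    rw [real_inner_comm (Y x) (Z x), real_inner_comm (X x) (Z x)]
    ring
  add {Z Z'} hZ hZ' := by
    have : CompleteSpace E := FiniteDimensional.complete ℝ E
    simp [koszul, inner_add_right, inner_add_left,
      mvfderiv_fun_add (mdifferentiableAt_inner hY hZ) (mdifferentiableAt_inner hY hZ'),
      mvfderiv_fun_add (mdifferentiableAt_inner hX hZ) (mdifferentiableAt_inner hX hZ'),
      mlieBracket_add_right hZ hZ']
    ring

lemma koszul_tensorial_left {Y Z : Π x : M, TangentSpace I x} {x : M}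
    (hY : MDiffAt (T% Y) x) (hZ : MDiffAt (T% Z) x) :
    TensorialAt I E (fun X ↦ koszul X Y Z x) x where
  smul {f X} hf hX := by
    have : CompleteSpace E := FiniteDimensional.complete ℝ E
    simp [koszul, inner_smul_right, inner_smul_left, inner_add_left,
      mvfderiv_fun_mul hf (mdifferentiableAt_inner hX hZ), mvfderiv_fun_mul hf (mdifferentiableAt_inner hX hY),
      mlieBracket_smul_left hf hX]
    ring
  add {X X'} hX hX' := by
    have : CompleteSpace E := FiniteDimensional.complete ℝ E
    simp [koszul, inner_add_right, inner_add_left,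
      mvfderiv_fun_add (mdifferentiableAt_inner hX hZ) (mdifferentiableAt_inner hX' hZ),
      mvfderiv_fun_add (mdifferentiableAt_inner hX hY) (mdifferentiableAt_inner hX' hY),
      mlieBracket_add_left hX hX']
    ring

lemma koszul_add_middle {X Y Y' Z : Π x : M, TangentSpace I x} {x : M}
    (hX : MDiffAt (T% X) x) (hY : MDiffAt (T% Y) x) (hY' : MDiffAt (T% Y') x)
    (hZ : MDiffAt (T% Z) x) :
    koszul X (Y + Y') Z x = koszul X Y Z x + koszul X Y' Z x := by
  have : CompleteSpace E := FiniteDimensional.complete ℝ E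
  simp [koszul, inner_add_right, inner_add_left,
    mvfderiv_fun_add (mdifferentiableAt_inner hY hZ) (mdifferentiableAt_inner hY' hZ),
    mvfderiv_fun_add (mdifferentiableAt_inner hX hY) (mdifferentiableAt_inner hX hY'),
    mlieBracket_add_right hY hY', mlieBracket_add_left hY hY']
  ring

lemma koszul_smul_middle {f : M → ℝ} {X Y Z : Π x : M, TangentSpace I x} {x : M}
    (hf : MDiffAt f x) (hX : MDiffAt (T% X) x) (hY : MDiffAt (T% Y) x)
    (hZ : MDiffAt (T% Z) x) :
    koszul X (f • Y) Z x = f x * koszul X Y Z x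
      + 2 * (d% f x (X x) * inner ℝ (Y x) (Z x)) := by
  have : CompleteSpace E := FiniteDimensional.complete ℝ E
  simp [koszul, inner_smul_right, inner_smul_left, inner_add_left,
    mvfderiv_fun_mul hf (mdifferentiableAt_inner hY hZ), mvfderiv_fun_mul hf (mdifferentiableAt_inner hX hY),
    mlieBracket_smul_right hf hY, mlieBracket_smul_left hf hY]
  rw [real_inner_comm (X x) (Y x)]
  ring

/-- For a vector field `Y` differentiable at `x`, the bilinear form
`(v, w) ↦ 2 g(∇_v Y, w)` on the tangent space at `x`. -/
def koszulForm (Y : Π x : M, TangentSpace I x) (x : M) (hY : MDiffAt (T% Y) x) :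
    TangentSpace I x →L[ℝ] TangentSpace I x →L[ℝ] ℝ :=
  TensorialAt.mkHom₂ (F := E) (F' := E) (I := I) (fun X Z ↦ koszul X Y Z x) x
    (fun _ hZ ↦ koszul_tensorial_left hY hZ) (fun _ hX ↦ koszul_tensorial_right hX hY)

instance finiteDimensional_tangentSpace (x : M) : FiniteDimensional ℝ (TangentSpace I x) :=
  inferInstanceAs (FiniteDimensional ℝ E)

instance completeSpace_tangentSpace (x : M) : CompleteSpace (TangentSpace I x) :=
  FiniteDimensional.complete ℝ _

open Classical in
/-- The function underlying the Levi-Civita connection: at a point `x` where `Y` is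
differentiable, `∇_v Y` is the vector with `g(∇_v Y, w) = koszulForm Y x v w / 2` for all `w`
(and, by convention, it is `0` where `Y` is not differentiable). -/
def leviCivitaFun (Y : Π x : M, TangentSpace I x) (x : M) :
    TangentSpace I x →L[ℝ] TangentSpace I x :=
  if hY : MDiffAt (T% Y) x then
    LinearMap.toContinuousLinearMap
      { toFun := fun v ↦ (InnerProductSpace.toDual ℝ (TangentSpace I x)).symm
          ((1 / 2 : ℝ) • koszulForm Y x hY v)
        map_add' := fun v w ↦ by simp
        map_smul' := fun c v ↦ by simp [smul_comm c] }
  else 0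

/-- The Koszul formula. -/
lemma inner_leviCivitaFun {X Y Z : Π x : M, TangentSpace I x} {x : M}
    (hX : MDiffAt (T% X) x) (hY : MDiffAt (T% Y) x) (hZ : MDiffAt (T% Z) x) :
    inner ℝ (leviCivitaFun Y x (X x)) (Z x) = koszul X Y Z x / 2 := by
  have h : koszulForm Y x hY (X x) (Z x) = koszul X Y Z x :=
    TensorialAt.mkHom₂_apply _ _ hX hZ
  simp only [leviCivitaFun, dif_pos hY, LinearMap.coe_toContinuousLinearMap', LinearMap.coe_mk,
    AddHom.coe_mk, InnerProductSpace.toDual_symm_apply, smul_apply, h, smul_eq_mul]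
  ring

/-- The Levi-Civita connection of the Riemannian metric. -/
def leviCivita : CovariantDerivative I E (TangentSpace I : M → Type _) where
  toFun := leviCivitaFun
  isCovariantDerivativeOnUniv :=
    { add := fun {Y Y'} {x} hY hY' _ ↦ by
        refine ContinuousLinearMap.ext fun v ↦ ext_inner_right ℝ fun w ↦ ?_
        have hv := FiberBundle.mdifferentiableAt_extend I E v
        have hw := FiberBundle.mdifferentiableAt_extend I E w
        have h := inner_leviCivitaFun hv (mdifferentiableAt_add_section hY hY') hw
        have h₁ := inner_leviCivitaFun hv hY hw
        have h₂ := inner_leviCivitaFun hv hY' hw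
        have h₃ := koszul_add_middle hv hY hY' hw
        simp only [FiberBundle.extend_apply_self] at h h₁ h₂
        rw [add_apply, inner_add_left, h₁, h₂]
        refine h.trans ?_
        rw [← add_div, ← h₃]
      leibniz := fun {Y f x} hY hf _ ↦ by
        refine ContinuousLinearMap.ext fun v ↦ ext_inner_right ℝ fun w ↦ ?_
        have hv := FiberBundle.mdifferentiableAt_extend I E v
        have hw := FiberBundle.mdifferentiableAt_extend I E w
        have h := inner_leviCivitaFun hv (hf.smul_section hY) hw
        have h₁ := inner_leviCivitaFun hv hY hw
        have h₃ := koszul_smul_middle hf hv hY hw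
        simp only [FiberBundle.extend_apply_self] at h h₁ h₃
        simp only [add_apply, smul_apply, ContinuousLinearMap.smulRight_apply, inner_add_left,
          real_inner_smul_left, h₁]
        refine h.trans ?_
        refine (congrArg (· / 2) h₃).trans ?_
        ring }

/-- The Levi-Civita connection is torsion-free. -/
theorem leviCivita_torsion :
    have : CompleteSpace E := FiniteDimensional.complete ℝ E
    (leviCivita (I := I) (M := M)).torsion = 0 := by
  have : CompleteSpace E := FiniteDimensional.complete ℝ E
  refine (CovariantDerivative.torsion_eq_zero_iff _).2 fun {X Y x} hX hY ↦
    ext_inner_right ℝ fun w ↦ ?_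
  have hw := FiberBundle.mdifferentiableAt_extend I E w
  have h₁ := inner_leviCivitaFun hX hY hw
  have h₂ := inner_leviCivitaFun hY hX hw
  have h₃ := koszul_swap (X := X) (Y := Y) (Z := FiberBundle.extend E w) (x := x)
  simp only [FiberBundle.extend_apply_self] at h₁ h₂ h₃
  rw [inner_sub_left]
  change inner ℝ (leviCivitaFun Y x (X x)) w - inner ℝ (leviCivitaFun X x (Y x)) w = _
  linarith

/-- The Levi-Civita connection is compatible with the metric. -/
theorem leviCivita_metric {X Y Z : Π x : M, TangentSpace I x} {x : M}
    (hX : MDiffAt (T% X) x) (hY : MDiffAt (T% Y) x) (hZ : MDiffAt (T% Z) x) :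
    d% (fun y ↦ (inner ℝ (Y y) (Z y) : ℝ)) x (X x)
      = inner ℝ (leviCivita Y x (X x)) (Z x) + inner ℝ (Y x) (leviCivita Z x (X x)) := by
  have h₁ := inner_leviCivitaFun hX hY hZ
  have h₂ := inner_leviCivitaFun hX hZ hY
  have h₃ := koszul_add_swap (X := X) (Y := Y) (Z := Z) (x := x)
  rw [real_inner_comm (leviCivita Z x (X x))]
  change _ = inner ℝ (leviCivitaFun Y x (X x)) (Z x) + inner ℝ (leviCivitaFun Z x (X x)) (Y x)
  linarith

/-! ### Kähler and hyperkähler structures, Killing fields -/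

/-- The endomorphism field `J` is parallel for the Levi-Civita connection:
`∇_v (J X) = J (∇_v X)`. -/
def IsParallel (J : EndField I M) : Prop :=
  ∀ (x : M) (X : Π x : M, TangentSpace I x), MDiffAt (T% X) x →
    ∀ v : TangentSpace I x, leviCivita (J.app X) x v = J x (leviCivita X x v)

/-- `J` is a Kähler structure on the Riemannian manifold `M`: a complex structure which is
orthogonal for the metric and parallel for the Levi-Civita connection. -/
structure IsKahler (J : EndField I M) : Prop where
  isComplexStructure : IsComplexStructure J
  orthogonal (x : M) (v w : TangentSpace I x) : (inner ℝ (J x v) (J x w) : ℝ) = inner ℝ v w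
  parallel : IsParallel J

/-- `(J 0, J 1, J 2)` is a hyperkähler structure on the Riemannian manifold `M`: three Kähler
structures satisfying the quaternion relations (all of them follow from `J 0 ∘ J 1 = J 2` and
`(J i)² = -1`). -/
structure IsHyperkahler (J : Fin 3 → EndField I M) : Prop where
  isKahler (i : Fin 3) : IsKahler (J i)
  quaternion (x : M) (v : TangentSpace I x) : J 0 x (J 1 x v) = J 2 x v

/-- The hyperkähler sphere: all `a₀ J₀ + a₁ J₁ + a₂ J₂` with real constants `aᵢ` such that
`a₀² + a₁² + a₂² = 1`. -/
def hyperkahlerSphere (J : Fin 3 → EndField I M) : Set (EndField I M) :=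
  {K | ∃ a : Fin 3 → ℝ, ∑ i, a i ^ 2 = 1 ∧ ∀ x : M, K x = ∑ i, a i • J i x}

/-- The Lie derivative of the metric at `x`:
`(L_ξ g)(X, Y) = ξ (g(X, Y)) - g([ξ, X], Y) - g(X, [ξ, Y])`. -/
def lieDerivMetric (ξ X Y : Π x : M, TangentSpace I x) (x : M) : ℝ :=
  d% (fun y ↦ (inner ℝ (X y) (Y y) : ℝ)) x (ξ x)
    - inner ℝ (mlieBracket I ξ X x) (Y x) - inner ℝ (X x) (mlieBracket I ξ Y x)

/-- `ξ` is a Killing vector field: it is smooth and `L_ξ g = 0`. -/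
structure IsKilling (ξ : Π x : M, TangentSpace I x) : Prop where
  smooth : CMDiff ∞ (T% ξ)
  lieDeriv_eq_zero (x : M) (X Y : Π x : M, TangentSpace I x) :
    MDiffAt (T% X) x → MDiffAt (T% Y) x → lieDerivMetric ξ X Y x = 0

end LeviCivita

end General

end

end Hyperkahler

/-!
The covariant derivative `A = ∇ξ` of a Killing field is a skew-adjoint endomorphism field, and since
the Levi-Civita connection is torsion-free, `L_ξ J = [J, A]` for every parallel `J`
(`IsKahler.lieDerivEnd_eq`). In dimension four the Lie algebra `𝔰𝔬(4)` is the sum of the span of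
`J 0`, `J 1`, `J 2` and of the commutant of this span, so that
`[J i, A] = [J i, f 0 • J 0 + f 1 • J 1 + f 2 • J 2]` for three real functions `f i` on `M`
(`exists_commutator_eq`).

The functions `f i` are constant. Indeed a Killing field preserves the metric and the Lie bracket,
hence the Koszul formula (`IsKilling.deriv_koszul`) and the Levi-Civita connection. Therefore the
Lie derivative `L_ξ (J i) = [J i, A]` of a parallel endomorphism field is again parallel
(`isSmoothParallel_commutatorField`). Each `f i` is, up to a constant factor, the symmetric part of
a pairing `⟨[J j, A] v, J k w⟩` of two parallel fields, which has the form `c ⟨v, w⟩`, and such a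
function `c` has vanishing differential (`eq_of_isSmoothParallel`). Curvature does not enter.

If `a` is a unit vector proportional to `f`, then `J₀ = ∑ i, a i • J i` is Kähler
(`IsHyperkahler.isKahler_sum`), and it commutes with `∑ i, f i • J i`, so `L_ξ J₀ = [J₀, A] = 0`.
-/

namespace Hyperkahler

open scoped Topology

/-! ### Smooth vector fields and derivatives along them -/

section VectorFields

lemma two_le_infty : (2 : WithTop ℕ∞) ≤ ∞ :=
  ENat.natCast_le_of_coe_top_le_withTop le_rfl 2

lemma three_le_infty : (3 : WithTop ℕ∞) ≤ ∞ :=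
  ENat.natCast_le_of_coe_top_le_withTop le_rfl 3

variable {E : Type*} [NormedAddCommGroup E] [NormedSpace ℝ E]
  {H : Type*} [TopologicalSpace H] {I : ModelWithCorners ℝ E H}
  {M : Type*} [TopologicalSpace M] [ChartedSpace H M]

lemma mvfderiv_congr_nhds {f g : M → ℝ} {x : M} (h : f =ᶠ[𝓝 x] g) : d% f x = d% g x := by
  ext v
  change mfderiv% f x v = mfderiv% g x v
  rw [h.mfderiv_eq]
  rfl

variable [IsManifold I ∞ M]

lemma mdiffAt_of_smoothAt {X : Π x : M, TangentSpace I x} {x : M}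
    (hX : CMDiffAt ∞ (T% X) x) : MDiffAt (T% X) x :=
  hX.mdifferentiableAt (by simp)

lemma eventually_mdiffAt {X : Π x : M, TangentSpace I x} {x : M}
    (hX : CMDiffAt ∞ (T% X) x) : ∀ᶠ y in 𝓝 x, MDiffAt (T% X) y :=
  ((contMDiffAt_iff_contMDiffAt_nhds (by simp)).1 (hX.of_le (m := 1) (by simp))).mono
    fun _ h ↦ h.mdifferentiableAt (by simp)

lemma smoothAt_smul {f : M → ℝ} {X : Π x : M, TangentSpace I x} {x : M}
    (hf : CMDiffAt ∞ f x) (hX : CMDiffAt ∞ (T% X) x) : CMDiffAt ∞ (T% (f • X)) x :=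
  hf.smul_section hX

lemma eventually_mdiffAt_fun {f : M → ℝ} {x : M}
    (hf : CMDiffAt ∞ f x) : ∀ᶠ y in 𝓝 x, MDiffAt f y :=
  ((contMDiffAt_iff_contMDiffAt_nhds (by simp)).1 (hf.of_le (m := 1) (by simp))).mono
    fun _ h ↦ h.mdifferentiableAt (by simp)

lemma smoothAt_mlieBracket [FiniteDimensional ℝ E] {X Y : Π x : M, TangentSpace I x} {x : M}
    (hX : CMDiffAt ∞ (T% X) x) (hY : CMDiffAt ∞ (T% Y) x) :
    CMDiffAt ∞ (T% (mlieBracket I X Y)) x := by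
  have : CompleteSpace E := FiniteDimensional.complete ℝ E
  have : IsManifold I (minSmoothness ℝ 2) M :=
    IsManifold.of_le (n := ∞) (by simpa using! two_le_infty)
  have : IsManifold I (((⊤ : ℕ∞) : WithTop ℕ∞) + 1) M := inferInstanceAs (IsManifold I ∞ M)
  exact ContMDiffAt.mlieBracket_vectorField (m := ⊤) (n := ⊤) hX hY (by simp)

section Derivative

variable [RiemannianBundle (fun x : M ↦ TangentSpace I x)]
  [IsContMDiffRiemannianBundle I ∞ E (fun x : M ↦ TangentSpace I x)]

lemma smoothAt_inner {X Y : Π x : M, TangentSpace I x} {x : M}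
    (hX : CMDiffAt ∞ (T% X) x) (hY : CMDiffAt ∞ (T% Y) x) :
    CMDiffAt ∞ (fun y ↦ (inner ℝ (X y) (Y y) : ℝ)) x :=
  ContMDiffAt.inner_bundle (F := E) (E := fun x : M ↦ TangentSpace I x) hX hY

variable [FiniteDimensional ℝ E]

/-- The derivative of a smooth function along a smooth vector field is smooth. The product rule
`[X, f W] = (X f) W + f [X, W]`, for a field `W` that does not vanish at `x`, reduces this to the
smoothness of Lie brackets. -/
lemma smoothAt_deriv_along [Nontrivial E] {f : M → ℝ} {X : Π x : M, TangentSpace I x} {x : M}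
    (hf : CMDiffAt ∞ f x) (hX : CMDiffAt ∞ (T% X) x) :
    CMDiffAt ∞ (fun y ↦ d% f y (X y)) x := by
  have : CompleteSpace E := FiniteDimensional.complete ℝ E
  obtain ⟨w, hw⟩ : ∃ w : TangentSpace I x, w ≠ 0 := exists_ne (α := E) 0
  set W : Π x : M, TangentSpace I x := FiberBundle.extend E w
  have hW : CMDiffAt ∞ (T% W) x := FiberBundle.contMDiffAt_extend I E w
  have hWx : W x = w := FiberBundle.extend_apply_self E w
  have h1 : CMDiffAt ∞ (T% (mlieBracket I X (f • W) - f • mlieBracket I X W)) x :=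
    (smoothAt_mlieBracket hX (smoothAt_smul hf hW)).sub_section
      (smoothAt_smul hf (smoothAt_mlieBracket hX hW))
  have h2 := smoothAt_inner h1 hW
  have h3 := smoothAt_inner hW hW
  have hne : (inner ℝ (W x) (W x) : ℝ) ≠ 0 := by
    rw [hWx]; exact inner_self_ne_zero.2 hw
  have h4 := h2.div₀ h3 hne
  refine h4.congr_of_eventuallyEq ?_
  filter_upwards [eventually_mdiffAt_fun hf, eventually_mdiffAt hW,
    h3.continuousAt.eventually_ne hne] with y hfy hWy hy
  have := mlieBracket_smul_right (V := X) hfy hWy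
  simp only [Pi.div_apply, Pi.sub_apply, this, Pi.smul_apply', add_sub_cancel_right,
    real_inner_smul_left]
  field_simp

/-- `ξ (X f) = [ξ, X] f + X (ξ f)`: a consequence of the Jacobi identity for `ξ`, `X`, `f W`. -/
lemma deriv_along_mlieBracket [Nontrivial E] {f : M → ℝ} {ξ X : Π x : M, TangentSpace I x} {x : M}
    (hf : CMDiffAt ∞ f x) (hξ : CMDiffAt ∞ (T% ξ) x) (hX : CMDiffAt ∞ (T% X) x) :
    d% (fun y ↦ d% f y (X y)) x (ξ x)
      = d% f x (mlieBracket I ξ X x) + d% (fun y ↦ d% f y (ξ y)) x (X x) := by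
  have : CompleteSpace E := FiniteDimensional.complete ℝ E
  have : IsManifold I (minSmoothness ℝ 3) M :=
    IsManifold.of_le (n := ∞) (by simpa using! three_le_infty)
  -- expansion of `[U, [V, f W]]` by the product rule
  have key : ∀ {U V : Π x : M, TangentSpace I x}, CMDiffAt ∞ (T% U) x → CMDiffAt ∞ (T% V) x →
      ∀ {W : Π x : M, TangentSpace I x}, CMDiffAt ∞ (T% W) x →
      mlieBracket I U (mlieBracket I V (f • W)) x
        = (d% (fun y ↦ d% f y (V y)) x (U x) • W x + d% f x (V x) • mlieBracket I U W x)
          + (d% f x (U x) • mlieBracket I V W x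
            + f x • mlieBracket I U (mlieBracket I V W) x) := by
    intro U V hU hV W hW
    have e : mlieBracket I V (f • W) =ᶠ[𝓝 x]
        (fun y ↦ d% f y (V y)) • W + f • mlieBracket I V W := by
      filter_upwards [eventually_mdiffAt_fun hf, eventually_mdiffAt hW] with y hfy hWy
      exact mlieBracket_smul_right hfy hWy
    have hd := smoothAt_deriv_along hf hV
    have hb := smoothAt_mlieBracket hV hW
    rw [Filter.EventuallyEq.rfl.mlieBracket_vectorField_eq e,
      mlieBracket_add_right (mdiffAt_of_smoothAt (smoothAt_smul hd hW))
        (mdiffAt_of_smoothAt (smoothAt_smul hf hb)),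
      mlieBracket_smul_right (hd.mdifferentiableAt (by simp)) (mdiffAt_of_smoothAt hW),
      mlieBracket_smul_right (hf.mdifferentiableAt (by simp)) (mdiffAt_of_smoothAt hb)]
  obtain ⟨w, hw⟩ : ∃ w : TangentSpace I x, w ≠ 0 := exists_ne (α := E) 0
  set W : Π x : M, TangentSpace I x := FiberBundle.extend E w
  have hW : CMDiffAt ∞ (T% W) x := FiberBundle.contMDiffAt_extend I E w
  have hWx : W x = w := FiberBundle.extend_apply_self E w
  have h2 : ∀ {U : Π x : M, TangentSpace I x}, CMDiffAt ∞ (T% U) x →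
      CMDiffAt (minSmoothness ℝ 2) (T% U) x := fun h ↦ h.of_le (by simpa using! two_le_infty)
  have j1 := leibniz_identity_mlieBracket_apply (h2 hξ) (h2 hX) (h2 (smoothAt_smul hf hW))
  have j2 := leibniz_identity_mlieBracket_apply (h2 hξ) (h2 hX) (h2 hW)
  have j3 := mlieBracket_smul_right (V := mlieBracket I ξ X) (hf.mdifferentiableAt (by simp))
    (mdiffAt_of_smoothAt hW)
  rw [key hξ hX hW, key hX hξ hW, j2, j3] at j1
  have j4 : (d% (fun y ↦ d% f y (X y)) x (ξ x)
      - (d% f x (mlieBracket I ξ X x) + d% (fun y ↦ d% f y (ξ y)) x (X x))) • W x = 0 := by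
    rw [← sub_eq_zero] at j1
    rw [← j1]
    module
  rw [smul_eq_zero, hWx] at j4
  exact sub_eq_zero.1 (j4.resolve_right hw)

end Derivative

end VectorFields

/-! ### Killing fields and the Koszul formula -/

section Riemannian

variable {E : Type*} [NormedAddCommGroup E] [NormedSpace ℝ E]
  {H : Type*} [TopologicalSpace H] {I : ModelWithCorners ℝ E H}
  {M : Type*} [TopologicalSpace M] [ChartedSpace H M] [IsManifold I ∞ M]

lemma IsComplexStructure.smoothAt_app {J : EndField I M} (hJ : IsComplexStructure J)
    {X : Π x : M, TangentSpace I x} {x : M} (hX : CMDiffAt ∞ (T% X) x) :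
    CMDiffAt ∞ (T% (J.app X)) x :=
  ContMDiffAt.clm_bundle_apply (F₁ := E) (F₂ := E) (E₁ := fun x : M ↦ TangentSpace I x)
    (E₂ := fun x : M ↦ TangentSpace I x) (hJ.smooth x) hX

lemma IsComplexStructure.mdiffAt_app {J : EndField I M} (hJ : IsComplexStructure J)
    {X : Π x : M, TangentSpace I x} {x : M} (hX : MDiffAt (T% X) x) :
    MDiffAt (T% (J.app X)) x :=
  MDifferentiableAt.clm_bundle_apply (F₁ := E) (F₂ := E) (E₁ := fun x : M ↦ TangentSpace I x)
    (E₂ := fun x : M ↦ TangentSpace I x) ((hJ.smooth x).mdifferentiableAt (by simp)) hX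

variable [RiemannianBundle (fun x : M ↦ TangentSpace I x)]

lemma IsKilling.deriv_inner {ξ X Y : Π x : M, TangentSpace I x} (hξ : IsKilling ξ) {x : M}
    (hX : MDiffAt (T% X) x) (hY : MDiffAt (T% Y) x) :
    d% (fun y ↦ (inner ℝ (X y) (Y y) : ℝ)) x (ξ x)
      = inner ℝ (mlieBracket I ξ X x) (Y x) + inner ℝ (X x) (mlieBracket I ξ Y x) := by
  have := hξ.lieDeriv_eq_zero x X Y hX hY
  simp only [lieDerivMetric] at this
  linarith

variable [FiniteDimensional ℝ E]
  [IsContMDiffRiemannianBundle I ∞ E (fun x : M ↦ TangentSpace I x)]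

lemma IsKilling.deriv_deriv_inner [Nontrivial E] {ξ X Y Z : Π x : M, TangentSpace I x}
    (hξ : IsKilling ξ) {x : M}
    (hX : CMDiffAt ∞ (T% X) x) (hY : CMDiffAt ∞ (T% Y) x) (hZ : CMDiffAt ∞ (T% Z) x) :
    d% (fun y ↦ d% (fun y ↦ (inner ℝ (Y y) (Z y) : ℝ)) y (X y)) x (ξ x)
      = d% (fun y ↦ (inner ℝ (Y y) (Z y) : ℝ)) x (mlieBracket I ξ X x)
        + d% (fun y ↦ (inner ℝ (mlieBracket I ξ Y y) (Z y) : ℝ)) x (X x)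
        + d% (fun y ↦ (inner ℝ (Y y) (mlieBracket I ξ Z y) : ℝ)) x (X x) := by
  have hb := fun {U} (hU : CMDiffAt ∞ (T% U) x) ↦
    smoothAt_mlieBracket (hξ.smooth x) (X := ξ) (Y := U) hU
  have e : (fun y ↦ d% (fun y ↦ (inner ℝ (Y y) (Z y) : ℝ)) y (ξ y)) =ᶠ[𝓝 x]
      (fun y ↦ inner ℝ (mlieBracket I ξ Y y) (Z y) + inner ℝ (Y y) (mlieBracket I ξ Z y)) := by
    filter_upwards [eventually_mdiffAt hY, eventually_mdiffAt hZ] with y h1 h2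
    exact hξ.deriv_inner h1 h2
  rw [deriv_along_mlieBracket (smoothAt_inner hY hZ) (hξ.smooth x) hX, mvfderiv_congr_nhds e,
    mvfderiv_fun_add ((smoothAt_inner (hb hY) hZ).mdifferentiableAt (by simp))
      ((smoothAt_inner hY (hb hZ)).mdifferentiableAt (by simp)), add_assoc]
  rfl

/-- A Killing field preserves the expression in the Koszul formula, hence the Levi-Civita
connection. -/
lemma IsKilling.deriv_koszul [Nontrivial E] {ξ X Y Z : Π x : M, TangentSpace I x}
    (hξ : IsKilling ξ) {x : M}
    (hX : CMDiffAt ∞ (T% X) x) (hY : CMDiffAt ∞ (T% Y) x) (hZ : CMDiffAt ∞ (T% Z) x) :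
    d% (fun y ↦ koszul X Y Z y) x (ξ x)
      = koszul (mlieBracket I ξ X) Y Z x + koszul X (mlieBracket I ξ Y) Z x
        + koszul X Y (mlieBracket I ξ Z) x := by
  have : CompleteSpace E := FiniteDimensional.complete ℝ E
  have : IsManifold I (minSmoothness ℝ 3) M :=
    IsManifold.of_le (n := ∞) (by simpa using! three_le_infty)
  have hd := fun {U V W : Π x : M, TangentSpace I x} (hU : CMDiffAt ∞ (T% U) x)
    (hV : CMDiffAt ∞ (T% V) x) (hW : CMDiffAt ∞ (T% W) x) ↦
    (smoothAt_deriv_along (smoothAt_inner hV hW) hU).mdifferentiableAt (by simp)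
  have hi := fun {U V W : Π x : M, TangentSpace I x} (hU : CMDiffAt ∞ (T% U) x)
    (hV : CMDiffAt ∞ (T% V) x) (hW : CMDiffAt ∞ (T% W) x) ↦
    (smoothAt_inner (smoothAt_mlieBracket hU hV) hW).mdifferentiableAt (by simp)
  have hj : ∀ {U V W : Π x : M, TangentSpace I x}, CMDiffAt ∞ (T% U) x →
      CMDiffAt ∞ (T% V) x → CMDiffAt ∞ (T% W) x →
      d% (fun y ↦ (inner ℝ (mlieBracket I U V y) (W y) : ℝ)) x (ξ x)
        = inner ℝ (mlieBracket I (mlieBracket I ξ U) V x) (W x)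
          + inner ℝ (mlieBracket I U (mlieBracket I ξ V) x) (W x)
          + inner ℝ (mlieBracket I U V x) (mlieBracket I ξ W x) := by
    intro U V W hU hV hW
    have h2 : ∀ {U : Π x : M, TangentSpace I x}, CMDiffAt ∞ (T% U) x →
        CMDiffAt (minSmoothness ℝ 2) (T% U) x := fun h ↦ h.of_le (by simpa using! two_le_infty)
    rw [hξ.deriv_inner (mdiffAt_of_smoothAt (smoothAt_mlieBracket hU hV))
      (mdiffAt_of_smoothAt hW), leibniz_identity_mlieBracket_apply (h2 (hξ.smooth x)) (h2 hU)
      (h2 hV), inner_add_left]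
  have e : (fun y ↦ koszul X Y Z y) = (((((fun y ↦ d% (fun y ↦ inner ℝ (Y y) (Z y)) y (X y))
      + fun y ↦ d% (fun y ↦ inner ℝ (X y) (Z y)) y (Y y))
      - fun y ↦ d% (fun y ↦ inner ℝ (X y) (Y y)) y (Z y))
      + fun y ↦ inner ℝ (mlieBracket I X Y y) (Z y))
      - fun y ↦ inner ℝ (mlieBracket I X Z y) (Y y))
      - fun y ↦ (inner ℝ (mlieBracket I Y Z y) (X y) : ℝ) := rfl
  have a1 := hd hX hY hZ
  have a2 := hd hY hX hZ
  have a3 := hd hZ hX hY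
  have a4 := hi hX hY hZ
  have a5 := hi hX hZ hY
  have a6 := hi hY hZ hX
  rw [e, mvfderiv_sub ((((a1.add a2).sub a3).add a4).sub a5) a6,
    mvfderiv_sub (((a1.add a2).sub a3).add a4) a5, mvfderiv_add ((a1.add a2).sub a3) a4,
    mvfderiv_sub (a1.add a2) a3, mvfderiv_add a1 a2]
  simp only [add_apply, sub_apply, hξ.deriv_deriv_inner hX hY hZ,
    hξ.deriv_deriv_inner hY hX hZ, hξ.deriv_deriv_inner hZ hX hY, hj hX hY hZ, hj hX hZ hY,
    hj hY hZ hX, koszul]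
  ring

lemma leviCivita_torsion_free {X Y : Π x : M, TangentSpace I x} {x : M}
    (hX : MDiffAt (T% X) x) (hY : MDiffAt (T% Y) x) :
    mlieBracket I X Y x = leviCivita Y x (X x) - leviCivita X x (Y x) := by
  have : CompleteSpace E := FiniteDimensional.complete ℝ E
  exact (((leviCivita (I := I) (M := M)).torsion_eq_zero_iff).1 leviCivita_torsion hX hY).symm

lemma inner_leviCivita {X Y Z : Π x : M, TangentSpace I x} {x : M}
    (hX : MDiffAt (T% X) x) (hY : MDiffAt (T% Y) x) (hZ : MDiffAt (T% Z) x) :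
    inner ℝ (leviCivita Y x (X x)) (Z x) = koszul X Y Z x / 2 :=
  inner_leviCivitaFun hX hY hZ

/-- The covariant derivative of a Killing field is skew-adjoint. -/
lemma IsKilling.inner_leviCivita_self {ξ : Π x : M, TangentSpace I x} (hξ : IsKilling ξ) {x : M}
    (v w : TangentSpace I x) :
    (inner ℝ (leviCivita ξ x v) w : ℝ) + inner ℝ v (leviCivita ξ x w) = 0 := by
  have hv := FiberBundle.mdifferentiableAt_extend I E v
  have hw := FiberBundle.mdifferentiableAt_extend I E w
  have hξx := mdiffAt_of_smoothAt (hξ.smooth x)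
  have h1 := hξ.deriv_inner hv hw
  have h2 := leviCivita_metric hξx hv hw
  rw [leviCivita_torsion_free hξx hv, leviCivita_torsion_free hξx hw, inner_sub_left,
    inner_sub_right, h2] at h1
  simp only [FiberBundle.extend_apply_self] at h1
  linarith

lemma IsKahler.inner_app_left {J : EndField I M} (hJ : IsKahler J) (x : M)
    (v w : TangentSpace I x) : (inner ℝ (J x v) w : ℝ) = -inner ℝ v (J x w) := by
  have := hJ.orthogonal x v (J x w)
  rw [hJ.isComplexStructure.sq, inner_neg_right] at this
  linarith

/-- For `J` parallel, `L_ξ J` is the commutator `[J, ∇ξ]`. -/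
lemma IsKahler.lieDerivEnd_eq {J : EndField I M} (hJ : IsKahler J)
    {ξ X : Π x : M, TangentSpace I x} {x : M} (hξ : MDiffAt (T% ξ) x) (hX : MDiffAt (T% X) x) :
    lieDerivEnd ξ J X x = J x (leviCivita ξ x (X x)) - leviCivita ξ x (J x (X x)) := by
  rw [lieDerivEnd, leviCivita_torsion_free hξ (hJ.isComplexStructure.mdiffAt_app hX),
    leviCivita_torsion_free hξ hX, hJ.parallel x X hX, map_sub]
  simp only [EndField.app]
  abel

end Riemannian

/-! ### Parallel endomorphism fields -/

section Parallel

variable {E : Type*} [NormedAddCommGroup E] [NormedSpace ℝ E]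
  {H : Type*} [TopologicalSpace H] {I : ModelWithCorners ℝ E H}
  {M : Type*} [TopologicalSpace M] [ChartedSpace H M]

/-- A real function on a connected manifold without boundary whose differential vanishes
identically is constant. -/
lemma eq_of_mvfderiv_eq_zero [IsManifold I ∞ M] [I.Boundaryless] [ConnectedSpace M] {f : M → ℝ}
    (hf : ∀ x, MDiffAt f x) (hf' : ∀ x, d% f x = 0) (x y : M) : f x = f y := by
  refine IsLocallyConstant.apply_eq_of_preconnectedSpace
    ((IsLocallyConstant.iff_eventually_eq f).2 fun x ↦ ?_) x y
  have hg : ∀ z ∈ (extChartAt I x).target,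
      HasFDerivAt (f ∘ (extChartAt I x).symm) (0 : E →L[ℝ] ℝ) z := by
    intro z hz
    have h1 : MDiffAt (extChartAt I x).symm z :=
      ((contMDiffOn_extChartAt_symm (n := ∞) x).contMDiffAt
        ((isOpen_extChartAt_target x).mem_nhds hz)).mdifferentiableAt (by simp)
    have h2 := (hf ((extChartAt I x).symm z)).hasMFDerivAt
    have h3 : mfderiv% f ((extChartAt I x).symm z) = 0 := by
      ext v
      exact congrArg (fun L ↦ L v) (hf' ((extChartAt I x).symm z))
    rw [h3] at h2
    have h4 := h2.comp z h1.hasMFDerivAt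
    rw [ContinuousLinearMap.zero_comp] at h4
    exact h4.hasFDerivAt
  obtain ⟨r, hr, hball⟩ := Metric.isOpen_iff.1 (isOpen_extChartAt_target (I := I) x) _
    (mem_extChartAt_target (I := I) x)
  have hmem : (extChartAt I x) ⁻¹' Metric.ball (extChartAt I x x) r ∈ 𝓝 x :=
    (continuousAt_extChartAt (I := I) x).preimage_mem_nhds (Metric.ball_mem_nhds _ hr)
  filter_upwards [hmem, extChartAt_source_mem_nhds (I := I) x] with y hy hys
  have := Metric.isOpen_ball.is_const_of_fderiv_eq_zero
    (convex_ball (extChartAt I x x) r).isPreconnected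
    (fun z hz ↦ (hg z (hball hz)).differentiableAt.differentiableWithinAt)
    (fun z hz ↦ (hg z (hball hz)).fderiv) hy (Metric.mem_ball_self hr)
  simpa only [Function.comp_apply, (extChartAt I x).left_inv hys, extChartAt_to_inv] using this

variable [FiniteDimensional ℝ E] [IsManifold I ∞ M]
  [RiemannianBundle (fun x : M ↦ TangentSpace I x)]
  [IsContMDiffRiemannianBundle I ∞ E (fun x : M ↦ TangentSpace I x)]

/-- The endomorphism field `K` maps smooth vector fields to smooth vector fields and commutes
with the Levi-Civita connection on them. Testing on smooth fields only suffices for the argument and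
avoids discussing the smoothness of `K` as a section of the endomorphism bundle. -/
structure IsSmoothParallel (K : EndField I M) : Prop where
  smoothAt_app {X : Π x : M, TangentSpace I x} {x : M} :
    CMDiffAt ∞ (T% X) x → CMDiffAt ∞ (T% (K.app X)) x
  leviCivita_app {X : Π x : M, TangentSpace I x} {x : M} :
    CMDiffAt ∞ (T% X) x → ∀ v, leviCivita (K.app X) x v = K x (leviCivita X x v)

lemma IsKahler.isSmoothParallel {J : EndField I M} (hJ : IsKahler J) : IsSmoothParallel J where
  smoothAt_app h := hJ.isComplexStructure.smoothAt_app h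
  leviCivita_app h v := hJ.parallel _ _ (mdiffAt_of_smoothAt h) v

/-- The field of commutators `[J, ∇ξ]`. -/
noncomputable def commutatorField (J : EndField I M) (ξ : Π x : M, TangentSpace I x) :
    EndField I M :=
  fun x ↦ J x ∘L leviCivita ξ x - leviCivita ξ x ∘L J x

lemma commutatorField_apply (J : EndField I M) (ξ : Π x : M, TangentSpace I x) (x : M)
    (v : TangentSpace I x) :
    commutatorField J ξ x v = J x (leviCivita ξ x v) - leviCivita ξ x (J x v) := rfl

lemma inner_commutatorField {J : EndField I M} (hJ : IsKahler J)
    {ξ : Π x : M, TangentSpace I x} (hξ : IsKilling ξ) {x : M} (v w : TangentSpace I x) :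
    (inner ℝ (commutatorField J ξ x v) w : ℝ) = -inner ℝ v (commutatorField J ξ x w) := by
  have h1 := hξ.inner_leviCivita_self v (J x w)
  have h2 := hξ.inner_leviCivita_self (J x v) w
  have h3 := hJ.inner_app_left x (leviCivita ξ x v) w
  have h4 := hJ.inner_app_left x v (leviCivita ξ x w)
  rw [commutatorField_apply, commutatorField_apply, inner_sub_left, inner_sub_right]
  linarith

/-- For a Killing field `ξ` and a Kähler structure `J`, the endomorphism field `L_ξ J = [J, ∇ξ]`
is parallel, because the flow of `ξ` preserves the Levi-Civita connection. -/
lemma isSmoothParallel_commutatorField [Nontrivial E] {J : EndField I M} (hJ : IsKahler J)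
    {ξ : Π x : M, TangentSpace I x} (hξ : IsKilling ξ) :
    IsSmoothParallel (commutatorField J ξ) := by
  have hJs := fun {U : Π x : M, TangentSpace I x} {x : M} (h : CMDiffAt ∞ (T% U) x) ↦
    hJ.isComplexStructure.smoothAt_app h
  have hbr := fun {U : Π x : M, TangentSpace I x} {x : M} (h : CMDiffAt ∞ (T% U) x) ↦
    smoothAt_mlieBracket (hξ.smooth x) h
  have happ : ∀ {U : Π x : M, TangentSpace I x} {x : M}, MDiffAt (T% U) x →
      (commutatorField J ξ).app U x
        = (mlieBracket I ξ (J.app U) - J.app (mlieBracket I ξ U)) x := fun {U x} h ↦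
    (hJ.lieDerivEnd_eq (mdiffAt_of_smoothAt (hξ.smooth x)) h).symm
  have hev : ∀ {U : Π x : M, TangentSpace I x} {x : M}, CMDiffAt ∞ (T% U) x →
      ∀ᶠ y in 𝓝 x, (commutatorField J ξ).app U y
        = (mlieBracket I ξ (J.app U) - J.app (mlieBracket I ξ U)) y := fun h ↦
    (eventually_mdiffAt h).mono fun y hy ↦ happ hy
  have hsub : ∀ {U : Π x : M, TangentSpace I x} {x : M}, CMDiffAt ∞ (T% U) x →
      CMDiffAt ∞ (T% (mlieBracket I ξ (J.app U) - J.app (mlieBracket I ξ U))) x := fun h ↦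
    (hbr (hJs h)).sub_section (hJs (hbr h))
  have hsm : ∀ {U : Π x : M, TangentSpace I x} {x : M}, CMDiffAt ∞ (T% U) x →
      CMDiffAt ∞ (T% ((commutatorField J ξ).app U)) x := fun h ↦
    (hsub h).congr_of_eventuallyEq ((hev h).mono fun y hy ↦ by simp only [hy])
  refine ⟨hsm, fun {Z x} hZ v ↦ ext_inner_right ℝ fun w ↦ ?_⟩
  set Y : Π x : M, TangentSpace I x := FiberBundle.extend E v
  set W : Π x : M, TangentSpace I x := FiberBundle.extend E w
  have hY : CMDiffAt ∞ (T% Y) x := FiberBundle.contMDiffAt_extend I E v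
  have hW : CMDiffAt ∞ (T% W) x := FiberBundle.contMDiffAt_extend I E w
  have hYx : Y x = v := FiberBundle.extend_apply_self E v
  have hWx : W x = w := FiberBundle.extend_apply_self E w
  have md := fun {U : Π x : M, TangentSpace I x} (h : CMDiffAt ∞ (T% U) x) ↦
    mdiffAt_of_smoothAt h
  -- the Koszul expression of `∇_Y (J U)` against `T` is minus that of `∇_Y U` against `J T`
  have hkos : ∀ {Y U T : Π x : M, TangentSpace I x} {y : M}, MDiffAt (T% Y) y → MDiffAt (T% U) y →
      MDiffAt (T% T) y → koszul Y (J.app U) T y = -koszul Y U (J.app T) y := by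
    intro Y U T y h1 h2 h3
    have e1 := inner_leviCivita h1 (hJ.isComplexStructure.mdiffAt_app h2) h3
    have e2 := inner_leviCivita h1 h2 (hJ.isComplexStructure.mdiffAt_app h3)
    rw [hJ.parallel y U h2, hJ.inner_app_left] at e1
    change -(inner ℝ (leviCivita U y (Y y)) (J.app T y) : ℝ) = _ at e1
    linarith
  have hd : d% (fun y ↦ koszul Y (J.app Z) W y) x (ξ x)
      = -d% (fun y ↦ koszul Y Z (J.app W) y) x (ξ x) := by
    have e : (fun y ↦ koszul Y (J.app Z) W y) =ᶠ[𝓝 x] -(fun y ↦ koszul Y Z (J.app W) y) := by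
      filter_upwards [eventually_mdiffAt hY, eventually_mdiffAt hZ, eventually_mdiffAt hW]
        with y h1 h2 h3
      exact hkos h1 h2 h3
    rw [mvfderiv_congr_nhds e, mvfderiv_neg]
    rfl
  rw [hξ.deriv_koszul hY (hJs hZ) hW, hξ.deriv_koszul hY hZ (hJs hW)] at hd
  have e1 := hkos (md (hbr hY)) (md hZ) (md hW)
  have e2 := hkos (md hY) (md hZ) (md (hbr hW))
  have e3 := hkos (md hY) (md (hbr hZ)) (md hW)
  have f1 := inner_leviCivita (md hY) (md (hbr (hJs hZ))) (md hW)
  have f2 := inner_leviCivita (md hY) (md (hJs (hbr hZ))) (md hW)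
  have f3 := inner_leviCivita (md hY) (md hZ) (md (hbr (hJs hW)))
  have f4 := inner_leviCivita (md hY) (md hZ) (md (hJs (hbr hW)))
  have hcov := (leviCivita (I := I) (M := M)).isCovariantDerivativeOn (s := Set.univ)
  have g1 : leviCivita ((commutatorField J ξ).app Z) x
      = leviCivita (mlieBracket I ξ (J.app Z) - J.app (mlieBracket I ξ Z)) x :=
    hcov.congr_of_eventuallyEq (md (hsm hZ)) (md (hsub hZ)) Filter.univ_mem (hev hZ)
  have g2 : leviCivita (mlieBracket I ξ (J.app Z)) x
      = leviCivita (mlieBracket I ξ (J.app Z) - J.app (mlieBracket I ξ Z)) x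
        + leviCivita (J.app (mlieBracket I ξ Z)) x := by
    conv_lhs => rw [← sub_add_cancel (mlieBracket I ξ (J.app Z)) (J.app (mlieBracket I ξ Z))]
    exact hcov.add (md (hsub hZ)) (md (hJs (hbr hZ)))
  have g3 : commutatorField J ξ x w = mlieBracket I ξ (J.app W) x - J.app (mlieBracket I ξ W) x := by
    rw [← hWx]
    exact happ (md hW)
  rw [inner_commutatorField hJ hξ, g1, g3, inner_sub_right]
  rw [g2, add_apply, inner_add_left] at f1
  rw [hYx] at f1 f2 f3 f4
  rw [hWx] at f1 f2
  linarith

/-- If `P` and `Q` are parallel and the symmetric part of `⟨P v, Q w⟩` is `c ⟨v, w⟩`, then the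
function `c` is constant. -/
lemma eq_of_isSmoothParallel [Nontrivial E] [I.Boundaryless] [ConnectedSpace M]
    {P Q : EndField I M} (hP : IsSmoothParallel P) (hQ : IsSmoothParallel Q) {c : M → ℝ}
    (hc : ∀ (x : M) (v w : TangentSpace I x),
      (inner ℝ (P x v) (Q x w) : ℝ) + inner ℝ (P x w) (Q x v) = 2 * c x * inner ℝ v w)
    (x y : M) : c x = c y := by
  have key : ∀ x, MDiffAt c x ∧ d% c x = 0 := by
    intro x
    obtain ⟨w, hw⟩ : ∃ w : TangentSpace I x, w ≠ 0 := exists_ne (α := E) 0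
    set W : Π x : M, TangentSpace I x := FiberBundle.extend E w
    have hW : CMDiffAt ∞ (T% W) x := FiberBundle.contMDiffAt_extend I E w
    have hWx : W x = w := FiberBundle.extend_apply_self E w
    have hPW := hP.smoothAt_app hW
    have hQW := hQ.smoothAt_app hW
    have hn := smoothAt_inner hW hW
    have hne : (inner ℝ (W x) (W x) : ℝ) ≠ 0 := by
      rw [hWx]; exact inner_self_ne_zero.2 hw
    have hPQ : (fun y ↦ (inner ℝ (P.app W y) (Q.app W y) : ℝ))
        = fun y ↦ c y * inner ℝ (W y) (W y) := by
      ext y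
      have := hc y (W y) (W y)
      simp only [EndField.app]
      linarith
    -- near `x` the function `c` is the quotient `⟨P W, Q W⟩ / ⟨W, W⟩` of smooth functions
    have hcx : MDiffAt c x := by
      have h := ((smoothAt_inner hPW hQW).div₀ hn hne).congr_of_eventuallyEq (f₁ := c) (by
        filter_upwards [hn.continuousAt.eventually_ne hne] with y hy
        have : (inner ℝ (P.app W y) (Q.app W y) : ℝ) = c y * inner ℝ (W y) (W y) :=
          congrFun hPQ y
        simp only [Pi.div_apply, this]
        field_simp)
      exact h.mdifferentiableAt (by simp)
    refine ⟨hcx, ?_⟩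
    ext v
    set V : Π x : M, TangentSpace I x := FiberBundle.extend E v
    have hV : MDiffAt (T% V) x := FiberBundle.mdifferentiableAt_extend I E v
    have hVx : V x = v := FiberBundle.extend_apply_self E v
    have h1 := leviCivita_metric hV (mdiffAt_of_smoothAt hPW) (mdiffAt_of_smoothAt hQW)
    have h2 := leviCivita_metric hV (mdiffAt_of_smoothAt hW) (mdiffAt_of_smoothAt hW)
    -- `d⟨P W, Q W⟩ = 2 c ⟨∇W, W⟩ = c d⟨W, W⟩`, and so the term `dc ⟨W, W⟩` vanishes
    have h3 := hc x (leviCivita W x (V x)) (W x)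
    rw [hPQ, mvfderiv_fun_mul hcx (hn.mdifferentiableAt (by simp)), hP.leviCivita_app hW,
      hQ.leviCivita_app hW] at h1
    simp only [add_apply, smul_apply, smul_eq_mul, EndField.app, h2] at h1
    have h4 := real_inner_comm (W x) (leviCivita W x (V x))
    have h5 : d% c x (V x) * inner ℝ (W x) (W x) = 0 := by
      rw [h4] at h1 h3
      linarith
    rw [hVx] at h5
    simpa using (mul_eq_zero.1 h5).resolve_right hne
  exact eq_of_mvfderiv_eq_zero (I := I) (fun x ↦ (key x).1) (fun x ↦ (key x).2) x y

end Parallel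

/-! ### Quaternionic linear algebra in dimension four -/

section QuaternionicAlgebra

variable {V : Type*} [NormedAddCommGroup V] [InnerProductSpace ℝ V]

/-- A unit vector `e` and its images under a quaternionic triple of skew-adjoint complex structures
form an orthonormal basis of a `4`-dimensional Euclidean space; the conclusion is the expansion of
a vector in this basis. -/
lemma exists_quaternionic_frame (hV : Module.finrank ℝ V = 4) {I J K : V →L[ℝ] V}
    (hI : ∀ v, I (I v) = -v) (hJ : ∀ v, J (J v) = -v) (hIJ : ∀ v, I (J v) = K v)
    (hJI : ∀ v, J (I v) = -K v)
    (sI : ∀ v w, (inner ℝ (I v) w : ℝ) = -inner ℝ v (I w))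
    (sJ : ∀ v w, (inner ℝ (J v) w : ℝ) = -inner ℝ v (J w)) :
    ∃ e : V, ∀ v, v = (inner ℝ e v : ℝ) • e + (inner ℝ (I e) v : ℝ) • I e
        + (inner ℝ (J e) v : ℝ) • J e + (inner ℝ (K e) v : ℝ) • K e := by
  have : Nontrivial V := Module.nontrivial_of_finrank_pos (R := ℝ) (by omega)
  obtain ⟨e, he⟩ := exists_norm_eq V zero_le_one
  have zI : ∀ v, (inner ℝ v (I v) : ℝ) = 0 := fun v ↦ by
    have := sI v v
    rw [real_inner_comm] at this
    linarith
  have zJ : ∀ v, (inner ℝ v (J v) : ℝ) = 0 := fun v ↦ by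
    have := sJ v v
    rw [real_inner_comm] at this
    linarith
  have nI : ∀ v w, (inner ℝ (I v) (I w) : ℝ) = inner ℝ v w := fun v w ↦ by
    rw [sI, hI, inner_neg_right, neg_neg]
  have nJ : ∀ v w, (inner ℝ (J v) (J w) : ℝ) = inner ℝ v w := fun v w ↦ by
    rw [sJ, hJ, inner_neg_right, neg_neg]
  have sK : ∀ v w, (inner ℝ (K v) w : ℝ) = -inner ℝ v (K w) := fun v w ↦ by
    rw [← hIJ, sI, sJ, hJI, inner_neg_right, neg_neg]
  have zK : ∀ v, (inner ℝ v (K v) : ℝ) = 0 := fun v ↦ by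
    have := sK v v
    rw [real_inner_comm] at this
    linarith
  have h1 : (inner ℝ e e : ℝ) = 1 := by rw [real_inner_self_eq_norm_sq, he, one_pow]
  have z1 : (inner ℝ (I e) (J e) : ℝ) = 0 := by rw [sI, hIJ, zK, neg_zero]
  have z2 : (inner ℝ (I e) (K e) : ℝ) = 0 := by rw [← hIJ, nI, zJ]
  have z3 : (inner ℝ (J e) (K e) : ℝ) = 0 := by
    rw [← neg_neg (K e), ← hJI, inner_neg_right, nJ, zI, neg_zero]
  have n1 : ‖I e‖ = 1 := by rw [norm_eq_sqrt_real_inner, nI, h1, Real.sqrt_one]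
  have n2 : ‖J e‖ = 1 := by rw [norm_eq_sqrt_real_inner, nJ, h1, Real.sqrt_one]
  have n3 : ‖K e‖ = 1 := by rw [← hIJ, norm_eq_sqrt_real_inner, nI, nJ, h1, Real.sqrt_one]
  have ho : Orthonormal ℝ ![e, I e, J e, K e] := by
    rw [orthonormal_iff_ite]
    intro i j
    fin_cases i <;> fin_cases j <;>
      simp [zI, zJ, zK, z1, z2, z3, n1, n2, n3, sI (w := e), sJ (w := e), sK (w := e),
        real_inner_comm (I e) (J e), real_inner_comm (I e) (K e), real_inner_comm (J e) (K e),
        he]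
  refine ⟨e, fun v ↦ ?_⟩
  have hb := (basisOfOrthonormalOfCardEqFinrank ho (by simp [hV])).span_eq
  rw [coe_basisOfOrthonormalOfCardEqFinrank] at hb
  have := (OrthonormalBasis.mk ho hb.ge).sum_repr' v
  simpa [Fin.sum_univ_four] using this.symm

/-- In dimension four, `𝔰𝔬(4) = 𝔰𝔭(1) ⊕ 𝔰𝔭(1)`: a skew-adjoint `A` is `f₀ I + f₁ J + f₂ K` up to an
endomorphism commuting with `I`, `J` and `K`. This is expressed through the commutators of `A` with
`I`, `J` and `K`. -/
lemma exists_commutator_eq (hV : Module.finrank ℝ V = 4) {I J K A : V →L[ℝ] V}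
    (hI : ∀ v, I (I v) = -v) (hJ : ∀ v, J (J v) = -v) (hIJ : ∀ v, I (J v) = K v)
    (hJI : ∀ v, J (I v) = -K v)
    (sI : ∀ v w, (inner ℝ (I v) w : ℝ) = -inner ℝ v (I w))
    (sJ : ∀ v w, (inner ℝ (J v) w : ℝ) = -inner ℝ v (J w))
    (sA : ∀ v w, (inner ℝ (A v) w : ℝ) + inner ℝ v (A w) = 0) :
    ∃ f : Fin 3 → ℝ, ∀ v,
      I (A v) - A (I v) = (2 * f 1) • K v - (2 * f 2) • J v ∧
      J (A v) - A (J v) = (2 * f 2) • I v - (2 * f 0) • K v ∧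
      K (A v) - A (K v) = (2 * f 0) • J v - (2 * f 1) • I v := by
  obtain ⟨e, hv⟩ := exists_quaternionic_frame hV hI hJ hIJ hJI sI sJ
  have sA' : ∀ v w, (inner ℝ v (A w) : ℝ) = -inner ℝ w (A v) := fun v w ↦ by
    have := sA v w
    rw [real_inner_comm] at this
    linarith
  have zA : ∀ v, (inner ℝ v (A v) : ℝ) = 0 := fun v ↦ by
    have := sA' v v
    linarith
  have hIK : ∀ v, I (K v) = -J v := fun v ↦ by rw [← hIJ, hI]
  have hJK : ∀ v, J (K v) = I v := fun v ↦ by rw [← neg_neg (K v), ← hJI, map_neg, hJ, neg_neg]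
  have hKI : ∀ v, K (I v) = J v := fun v ↦ by rw [← hIJ, hJI, map_neg, hIK, neg_neg]
  have hKJ : ∀ v, K (J v) = -I v := fun v ↦ by rw [← hIJ, hJ, map_neg]
  have hKK : ∀ v, K (K v) = -v := fun v ↦ by rw [← hIJ, hJK, hI]
  set p : ℝ := inner ℝ (I e) (A e)
  set q : ℝ := inner ℝ (J e) (A e)
  set r : ℝ := inner ℝ (K e) (A e)
  set s : ℝ := inner ℝ (J e) (A (I e))
  set t : ℝ := inner ℝ (K e) (A (I e))
  set u : ℝ := inner ℝ (K e) (A (J e))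
  have A0 : A e = p • I e + q • J e + r • K e := by
    have := hv (A e)
    rw [zA, zero_smul, zero_add] at this
    exact this
  have A1 : A (I e) = -p • e + s • J e + t • K e := by
    have := hv (A (I e))
    rw [zA, zero_smul, add_zero, sA'] at this
    exact this
  have A2 : A (J e) = -q • e + -s • I e + u • K e := by
    have := hv (A (J e))
    rw [zA, zero_smul, add_zero, sA' e, sA' (I e)] at this
    exact this
  have A3 : A (K e) = -r • e + -t • I e + -u • J e := by
    have := hv (A (K e))
    rw [zA, zero_smul, add_zero, sA' e, sA' (I e), sA' (J e)] at this
    exact this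
  -- `A - f₀ I - f₁ J - f₂ K` commutes with `I`, `J`, `K` exactly when its matrix in this frame is
  -- anti-self-dual, which determines the `fᵢ` as the self-dual part of the matrix of `A`
  refine ⟨![(p + u) / 2, (q - t) / 2, (r + s) / 2], fun v ↦ ?_⟩
  rw [hv v]
  generalize (inner ℝ e v : ℝ) = c0, (inner ℝ (I e) v : ℝ) = c1, (inner ℝ (J e) v : ℝ) = c2,
    (inner ℝ (K e) v : ℝ) = c3
  simp only [map_add, map_smul, map_neg, hI, hJ, hIJ, hJI, hIK, hJK, hKI, hKJ, hKK, A0, A1, A2, A3,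
    Matrix.cons_val]
  refine ⟨?_, ?_, ?_⟩ <;> module

end QuaternionicAlgebra

/-! ### The sphere of Kähler structures -/

section Sphere

variable {E : Type*} [NormedAddCommGroup E] [NormedSpace ℝ E] [FiniteDimensional ℝ E]
  {H : Type*} [TopologicalSpace H] {I : ModelWithCorners ℝ E H}
  {M : Type*} [TopologicalSpace M] [ChartedSpace H M] [IsManifold I ∞ M]
  [RiemannianBundle (fun x : M ↦ TangentSpace I x)]
  [IsContMDiffRiemannianBundle I ∞ E (fun x : M ↦ TangentSpace I x)]

/-- A parallel almost complex structure is integrable, since the Levi-Civita connection is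
torsion-free. -/
lemma IsParallel.nijenhuis_eq_zero {J : EndField I M} (hJ : IsParallel J)
    (hsq : ∀ (x : M) (v : TangentSpace I x), J x (J x v) = -v)
    {x : M} (hd : ∀ {X : Π x : M, TangentSpace I x}, MDiffAt (T% X) x → MDiffAt (T% (J.app X)) x)
    {X Y : Π x : M, TangentSpace I x} (hX : MDiffAt (T% X) x) (hY : MDiffAt (T% Y) x) :
    nijenhuis J X Y x = 0 := by
  rw [nijenhuis, leviCivita_torsion_free (hd hX) (hd hY), leviCivita_torsion_free (hd hX) hY,
    leviCivita_torsion_free hX (hd hY), leviCivita_torsion_free hX hY, hJ x X hX, hJ x Y hY]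
  simp only [map_sub, hJ x X hX, hJ x Y hY, hsq, EndField.app]
  abel

lemma IsHyperkahler.quaternion_swap {J : Fin 3 → EndField I M} (hJ : IsHyperkahler J) (x : M)
    (v : TangentSpace I x) : J 1 x (J 0 x v) = -J 2 x v := by
  have sq := fun i ↦ (hJ.isKahler i).isComplexStructure.sq x
  have h := sq 2 v
  rw [← hJ.quaternion, ← hJ.quaternion] at h
  have h2 := congrArg (J 0 x) h
  rw [sq, map_neg, neg_inj] at h2
  rw [← h2, sq, hJ.quaternion]

/-- Every unit combination of the three structures of a hyperkähler structure is Kähler. -/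
lemma IsHyperkahler.isKahler_sum {J : Fin 3 → EndField I M} (hJ : IsHyperkahler J) {a : Fin 3 → ℝ}
    (ha : ∑ i, a i ^ 2 = 1) : IsKahler (fun x : M ↦ ∑ i, a i • J i x) := by
  have sq := fun i ↦ (hJ.isKahler i).isComplexStructure.sq
  have h01 := hJ.quaternion
  have h10 := hJ.quaternion_swap
  have h02 : ∀ x v, J 0 x (J 2 x v) = -J 1 x v := fun x v ↦ by rw [← h01, sq]
  have h12 : ∀ x v, J 1 x (J 2 x v) = J 0 x v := fun x v ↦ by
    rw [← neg_neg (J 2 x v), ← h10, map_neg, sq, neg_neg]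
  have h20 : ∀ x v, J 2 x (J 0 x v) = J 1 x v := fun x v ↦ by
    rw [← h01, h10, map_neg, h02, neg_neg]
  have h21 : ∀ x v, J 2 x (J 1 x v) = -J 0 x v := fun x v ↦ by rw [← h01, sq, map_neg]
  have happ : ∀ (x : M) (v : TangentSpace I x),
      (∑ i, a i • J i x) v = a 0 • J 0 x v + a 1 • J 1 x v + a 2 • J 2 x v := fun x v ↦ by
    rw [Fin.sum_univ_three]
    rfl
  rw [Fin.sum_univ_three] at ha
  have hsq : ∀ (x : M) (v : TangentSpace I x),
      (∑ i, a i • J i x) ((∑ i, a i • J i x) v) = -v := by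
    intro x v
    rw [happ, happ]
    simp only [map_add, map_smul, sq, h01, h10, h02, h12, h20, h21]
    calc _ = -(a 0 ^ 2 + a 1 ^ 2 + a 2 ^ 2) • v := by module
      _ = -v := by rw [ha, neg_smul, one_smul]
  have hpar : IsParallel (fun x : M ↦ ∑ i, a i • J i x) := by
    intro x X hX v
    have hd := fun i ↦ (hJ.isKahler i).isComplexStructure.mdiffAt_app hX
    have e : EndField.app (fun x : M ↦ ∑ i, a i • J i x) X
        = a 0 • (J 0).app X + a 1 • (J 1).app X + a 2 • (J 2).app X := by
      ext y
      exact happ y (X y)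
    have hcov := (leviCivita (I := I) (M := M)).isCovariantDerivativeOn (s := Set.univ)
    have hs : ∀ i, MDiffAt (T% (a i • (J i).app X)) x := fun i ↦
      mdifferentiableAt_const.smul_section (hd i)
    have e1 := hcov.add (mdifferentiableAt_add_section (hs 0) (hs 1)) (hs 2)
    have e2 := hcov.add (hs 0) (hs 1)
    have e3 := fun i ↦ hcov.smul_const (a i) (hd i)
    rw [e2, e3 0, e3 1, e3 2] at e1
    rw [happ, e, ← (hJ.isKahler 0).parallel x X hX, ← (hJ.isKahler 1).parallel x X hX,
      ← (hJ.isKahler 2).parallel x X hX]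
    exact congrArg (fun L ↦ L v) e1
  have hsm : ContMDiff I (I.prod 𝓘(ℝ, E →L[ℝ] E)) ∞
      (fun x : M ↦ TotalSpace.mk' (E →L[ℝ] E)
        (E := fun x : M ↦ TangentSpace I x →L[ℝ] TangentSpace I x) x (∑ i, a i • J i x)) :=
    ContMDiff.sum_section fun i _ ↦
      ((hJ.isKahler i).isComplexStructure.smooth).const_smul_section
  refine ⟨⟨hsm, hsq, fun x X Y hX hY ↦ hpar.nijenhuis_eq_zero hsq (fun hZ ↦ ?_) hX hY⟩,
    fun x v w ↦ ?_, hpar⟩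
  · exact MDifferentiableAt.clm_bundle_apply (F₁ := E) (F₂ := E)
      (E₁ := fun x : M ↦ TangentSpace I x) (E₂ := fun x : M ↦ TangentSpace I x)
      ((hsm x).mdifferentiableAt (by simp)) hZ
  · have h : (inner ℝ ((∑ i, a i • J i x) v) ((∑ i, a i • J i x) w) : ℝ)
        = -inner ℝ v ((∑ i, a i • J i x) ((∑ i, a i • J i x) w)) := by
      generalize (∑ i, a i • J i x) w = w'
      rw [happ, happ]
      simp only [inner_add_left, inner_add_right, real_inner_smul_left, real_inner_smul_right,
        (hJ.isKahler _).inner_app_left]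
      ring
    rw [h, hsq, inner_neg_right, neg_neg]

end Sphere

end Hyperkahler

/-! ### Holomorphy of Killing fields -/

theorem theorem4p2 {M : Type*} [TopologicalSpace M] [ConnectedSpace M]
    [ChartedSpace (EuclideanSpace ℝ (Fin 4)) M] [IsManifold (𝓡 4) ∞ M]
    [RiemannianBundle (fun x : M ↦ TangentSpace (𝓡 4) x)]
    [IsContMDiffRiemannianBundle (𝓡 4) ∞ (EuclideanSpace ℝ (Fin 4))
      (fun x : M ↦ TangentSpace (𝓡 4) x)]
    (J : Fin 3 → Hyperkahler.EndField (𝓡 4) M) (hJ : Hyperkahler.IsHyperkahler J)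
    (ξ : Π x : M, TangentSpace (𝓡 4) x) (hξ : Hyperkahler.IsKilling ξ) :
    ∃ J₀ ∈ Hyperkahler.hyperkahlerSphere J,
      Hyperkahler.IsKahler J₀ ∧ Hyperkahler.IsHolomorphicField J₀ ξ := by
  have hdim : ∀ x : M, Module.finrank ℝ (TangentSpace (𝓡 4) x) = 4 := fun x ↦
    finrank_euclideanSpace_fin (𝕜 := ℝ) (n := 4)
  have hsk := fun i x ↦ (hJ.isKahler i).inner_app_left x
  have hsq := fun i x ↦ (hJ.isKahler i).isComplexStructure.sq x
  choose f hf using fun x ↦ Hyperkahler.exists_commutator_eq (hdim x) (hsq 0 x) (hsq 1 x)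
    (hJ.quaternion x) (hJ.quaternion_swap x) (hsk 0 x) (hsk 1 x) (hξ.inner_leviCivita_self (x := x))
  have hpar := fun i ↦ (hJ.isKahler i).isSmoothParallel
  have hcom := fun i ↦ Hyperkahler.isSmoothParallel_commutatorField (hJ.isKahler i) hξ
  have horth := fun i x ↦ (hJ.isKahler i).orthogonal x
  have h12 : ∀ (x : M) (v w : TangentSpace (𝓡 4) x),
      (inner ℝ (J 1 x v) (J 2 x w) : ℝ) + inner ℝ (J 1 x w) (J 2 x v) = 0 := fun x v w ↦ by
    rw [← hJ.quaternion x v, ← neg_neg (inner ℝ (J 1 x w) _), ← hsk 0 x, hJ.quaternion,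
      real_inner_comm, add_neg_cancel]
  have h02 : ∀ (x : M) (v w : TangentSpace (𝓡 4) x),
      (inner ℝ (J 0 x v) (J 2 x w) : ℝ) + inner ℝ (J 0 x w) (J 2 x v) = 0 := fun x v w ↦ by
    have h := hsk 1 x (J 0 x w) (J 0 x v)
    rw [hJ.quaternion_swap, hJ.quaternion_swap, inner_neg_left, inner_neg_right,
      real_inner_comm] at h
    linarith
  -- the fields `[J 1, ∇ξ] = 2 f 2 • J 0 - 2 f 0 • J 2` and `[J 0, ∇ξ] = 2 f 1 • J 2 - 2 f 2 • J 1`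
  -- are parallel; pairing them with `J 2` and `J 1` isolates the coefficients
  have hf0 : ∀ x y, f x 0 = f y 0 := fun x y ↦ by
    have := Hyperkahler.eq_of_isSmoothParallel (hcom 1) (hpar 2) (c := fun x ↦ -(2 * f x 0))
      (fun x v w ↦ by
        rw [Hyperkahler.commutatorField_apply, Hyperkahler.commutatorField_apply, (hf x v).2.1,
          (hf x w).2.1]
        simp only [inner_sub_left, real_inner_smul_left, horth, real_inner_comm v w]
        linear_combination 2 * f x 2 * h02 x v w) x y
    linarith
  have hf1 : ∀ x y, f x 1 = f y 1 := fun x y ↦ by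
    have := Hyperkahler.eq_of_isSmoothParallel (hcom 0) (hpar 2) (c := fun x ↦ 2 * f x 1)
      (fun x v w ↦ by
        rw [Hyperkahler.commutatorField_apply, Hyperkahler.commutatorField_apply, (hf x v).1,
          (hf x w).1]
        simp only [inner_sub_left, real_inner_smul_left, horth, real_inner_comm v w]
        linear_combination -2 * f x 2 * h12 x v w) x y
    linarith
  have hf2 : ∀ x y, f x 2 = f y 2 := fun x y ↦ by
    have := Hyperkahler.eq_of_isSmoothParallel (hcom 0) (hpar 1) (c := fun x ↦ -(2 * f x 2))
      (fun x v w ↦ by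
        rw [Hyperkahler.commutatorField_apply, Hyperkahler.commutatorField_apply, (hf x v).1,
          (hf x w).1]
        simp only [inner_sub_left, real_inner_smul_left, horth, real_inner_comm v w]
        have h := h12 x v w
        rw [real_inner_comm, real_inner_comm (J 2 x v)] at h
        linear_combination 2 * f x 1 * h) x y
    linarith
  obtain ⟨x₀⟩ : Nonempty M := inferInstance
  -- a unit vector `a` proportional to the constant vector `f`; arbitrary if `f = 0`
  obtain ⟨a, t, ha, hat⟩ : ∃ (a : Fin 3 → ℝ) (t : ℝ), ∑ i, a i ^ 2 = 1 ∧ ∀ i, f x₀ i = t * a i := by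
    rcases eq_or_ne (f x₀) 0 with h | h
    · exact ⟨Pi.single 0 1, 0, by simp [Fin.sum_univ_three], by simp [h]⟩
    · have hpos : 0 < ∑ i, f x₀ i ^ 2 := by
        obtain ⟨i, hi⟩ := Function.ne_iff.1 h
        exact Finset.sum_pos' (fun _ _ ↦ sq_nonneg _) ⟨i, Finset.mem_univ i, sq_pos_iff.2 hi⟩
      have hne := (Real.sqrt_pos.2 hpos).ne'
      refine ⟨fun i ↦ f x₀ i / √(∑ i, f x₀ i ^ 2), √(∑ i, f x₀ i ^ 2), ?_, fun i ↦ ?_⟩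
      · simp only [div_pow, Real.sq_sqrt hpos.le]
        rw [← Finset.sum_div, div_self hpos.ne']
      · field_simp
  refine ⟨_, ⟨a, ha, fun x ↦ rfl⟩, hJ.isKahler_sum ha, fun x X hX ↦ ?_⟩
  rw [(hJ.isKahler_sum ha).lieDerivEnd_eq (Hyperkahler.mdiffAt_of_smoothAt (hξ.smooth x)) hX]
  obtain ⟨e0, e1, e2⟩ := hf x (X x)
  simp only [hf0 x x₀, hf1 x x₀, hf2 x x₀, hat] at e0 e1 e2
  simp only [Fin.sum_univ_three, add_apply, smul_apply, map_add, map_smul]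
  calc _ = a 0 • (J 0 x (Hyperkahler.leviCivita ξ x (X x))
            - Hyperkahler.leviCivita ξ x (J 0 x (X x)))
          + a 1 • (J 1 x (Hyperkahler.leviCivita ξ x (X x))
            - Hyperkahler.leviCivita ξ x (J 1 x (X x)))
          + a 2 • (J 2 x (Hyperkahler.leviCivita ξ x (X x))
            - Hyperkahler.leviCivita ξ x (J 2 x (X x))) := by module
    _ = 0 := by rw [e0, e1, e2]; module
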